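/- For a bounded domain $\Omega\subset\mathbb C^n$ let $A(\Omega)$ be the algebra of continuous functions on $\overline\Omega$ that are holomorphic in $\Omega$; the Shilov (distinguished) boundary $\partial_s\Omega$ (also written $b\Omega$) is the smallest closed subset of $\overline\Omega$ on which every function of $A(\Omega)$ attains its maximum modulus over $\overline\Omega$. Let $$L_4=\Big\{z\in\mathbb C^4:\ \|z\|<1,\ 2\|z\|^2-\Big|\sum_{i=1}^4 z_i^2\Big|^2<1\Big\},\qquad \mathbb L_4=\{(z_1^2,z_2,z_3,z_4): z\in L_4\},$$ $$\mathbb F=\{(a_{11},a_{22},\det A,a_{12}+a_{21}):\ A=(a_{ij})\in M_2(\mathbb C),\ \|A\|<1\},$$ where $\|z\|$ is the Euclidean norm and $\|A\|$ the operator norm, and let $$\mathbb E=\{(x_1,x_2,x_3)\in\mathbb C^3:\ 1-x_1z_1-x_2z_2+x_3z_1z_2\neq 0 \text{ whenever } |z_1|\le 1,\ |z_2|\le 1\}$$ be the tetrablock. Let $$f(w_1,w_2,w_3,w_4)=(w_3+iw_4,\ -w_3+iw_4,\ -w_2^2-w_3^2-w_4^2-w_1,\ 2w_2).$$ Then the Shilov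 boundaries of $\mathbb L_4$, $\mathbb F$ and $\mathbb E$ exist, $f$ maps $\mathbb L_4$ biholomorphically onto $\mathbb F$, and $$\partial_s\mathbb F=f(\partial_s\mathbb L_4).$$ Moreover, for $(x,a,p,s)\in\mathbb C^4$ the following are equivalent: 1. $(x,a,p,s)\in\partial_s\mathbb F$; 2. there exist real numbers $\theta,x_1,x_2,x_3,x_4$ with $x_1^2+x_2^2+x_3^2+x_4^2=1$ such that $(x,a,p,s)=\big(e^{i\theta}(x_3+ix_4),\,-e^{i\theta}(x_3-ix_4),\,-e^{2i\theta},\,2e^{i\theta}x_2\big)$; 3. there exist $z,w,\eta\in\mathbb C$ with $|z|^2+|w|^2\le 1$ and $|\eta|=1$ such that $(x,a,p,s)=(\overline z,\,-\eta z,\,-\eta,\,w+\overline w\,\eta)$; 4. $(x,a,p)\in b\mathbb E$ and there exists $w\in\mathbb C$ such that $|x|^2+|w|^2\le 1$ and $s=w-\overline w\,p$. -/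

import Mathlib

/-- The algebra `A(Ω)`: functions continuous on the closure of `Ω` and holomorphic in `Ω`
(only the values on `closure Ω` matter). -/
def IsInDomainAlgebra {n : ℕ} (Ω : Set (Fin n → ℂ)) (g : (Fin n → ℂ) → ℂ) : Prop :=
  ContinuousOn g (closure Ω) ∧ DifferentiableOn ℂ g Ω

/-- The closed subsets of `closure Ω` on which every function of `A(Ω)` attains its maximum
modulus over `closure Ω`. -/
def closedBoundaries {n : ℕ} (Ω : Set (Fin n → ℂ)) : Set (Set (Fin n → ℂ)) :=
  {S | S ⊆ closure Ω ∧ IsClosed S ∧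
    ∀ g : (Fin n → ℂ) → ℂ, IsInDomainAlgebra Ω g →
      ∃ z ∈ S, ∀ w ∈ closure Ω, ‖g w‖ ≤ ‖g z‖}

/-- The Shilov (distinguished) boundary. If there is a smallest element of
`closedBoundaries Ω`, then this set is it. -/
def shilovBoundary {n : ℕ} (Ω : Set (Fin n → ℂ)) : Set (Fin n → ℂ) :=
  ⋂₀ closedBoundaries Ω

/-- `f` restricts to a biholomorphism of the open set `U` onto the open set `V`. -/
def IsBiholomorphismOn {n m : ℕ} (f : (Fin n → ℂ) → (Fin m → ℂ))
    (U : Set (Fin n → ℂ)) (V : Set (Fin m → ℂ)) : Prop :=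
  IsOpen U ∧ IsOpen V ∧ Set.BijOn f U V ∧ DifferentiableOn ℂ f U ∧
    ∃ g : (Fin m → ℂ) → (Fin n → ℂ), Set.InvOn g f U V ∧ DifferentiableOn ℂ g V

/-- The Lie ball `L_n` in `ℂⁿ` (squared Euclidean norms are written as explicit sums). -/
def lieBall (n : ℕ) : Set (Fin n → ℂ) :=
  {z | ∑ i, ‖z i‖ ^ 2 < 1 ∧ 2 * ∑ i, ‖z i‖ ^ 2 - ‖∑ i, z i ^ 2‖ ^ 2 < 1}

/-- The map `Λ₄(z₁, z₂, z₃, z₄) = (z₁², z₂, z₃, z₄)`. -/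
def Lambda4 (z : Fin 4 → ℂ) : Fin 4 → ℂ :=
  ![z 0 ^ 2, z 1, z 2, z 3]

/-- The domain `𝕃₄ = Λ₄(L₄)`. -/
def domainL4 : Set (Fin 4 → ℂ) :=
  Lambda4 '' lieBall 4

/-- `π(A) = (a₁₁, a₂₂, det A, a₁₂ + a₂₁)`. -/
def piF (A : Matrix (Fin 2) (Fin 2) ℂ) : Fin 4 → ℂ :=
  ![A 0 0, A 1 1, A.det, A 0 1 + A 1 0]

/-- The domain `𝔽`, the image under `π` of the open unit ball of the `2 × 2` matrices in the
operator norm induced by the Euclidean norm of `ℂ²`. -/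
noncomputable def domainF : Set (Fin 4 → ℂ) :=
  piF '' {A | ‖Matrix.toEuclideanCLM (n := Fin 2) (𝕜 := ℂ) A‖ < 1}

/-- The tetrablock. -/
def tetrablock : Set (Fin 3 → ℂ) :=
  {x | ∀ z₁ z₂ : ℂ, ‖z₁‖ ≤ 1 → ‖z₂‖ ≤ 1 →
    1 - x 0 * z₁ - x 1 * z₂ + x 2 * z₁ * z₂ ≠ 0}

/-- The polynomial map `f(w₁, w₂, w₃, w₄) =
(w₃ + i w₄, -w₃ + i w₄, -w₂² - w₃² - w₄² - w₁, 2 w₂)`. -/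
noncomputable def mapF (w : Fin 4 → ℂ) : Fin 4 → ℂ :=
  ![w 2 + Complex.I * w 3, -w 2 + Complex.I * w 3,
    -w 1 ^ 2 - w 2 ^ 2 - w 3 ^ 2 - w 0, 2 * w 1]

/-! Everything reduces to one family of domains: `lieSquare m`, the Lie ball of ℂ^(m+1) with its
first coordinate squared. 𝕃₄ is `lieSquare 3`, and polynomial automorphisms `mapF` of ℂ⁴ and `mapE`
of ℂ³ carry `lieSquare 3` onto 𝔽 and `lieSquare 2` onto the tetrablock. Such automorphisms transport
closed boundaries, so only the Shilov boundary of `lieSquare (m + 1)` has to be found.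

It is `lieSquareBoundary (m + 1)`, for two reasons. Each point of the domain is the centre of an
analytic disc with boundary in this set (`exists_disc_lieSquare`), so by the maximum principle the
set is a closed boundary. Each of its points is a peak point (`exists_peak_lieSquare`), so it lies
in every closed boundary.

The discs come from bidiscs: a vector z is u(a + ib) with |u| = 1 and a, b real and orthogonal, and
the complex plane through a and b meets the Lie ball in a bidisc whose torus consists of unimodular
multiples of real unit vectors.

For 𝔽, the linear map `spinMatrix` identifies L₄ with the unit ball of matrices and π with f ∘ Λ₄.
For the tetrablock, one inclusion follows from invertibility of 1 - AD for a contraction A and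
diagonal D, the other from norm inequalities. The four descriptions of the boundary then agree by
algebra on the unit circle. -/

open Complex Set Metric

/-! ### Closed boundaries from discs and peak points, and their transport -/

/-- A compact set that carries the boundaries of analytic discs through every point of `Ω` and
consists of peak points of `A(Ω)` is the smallest closed boundary. -/
theorem isLeast_closedBoundaries_of_discs_of_peaks {n : ℕ} {Ω S : Set (Fin n → ℂ)}
    (hS : IsCompact S) (hne : S.Nonempty) (hSΩ : S ⊆ closure Ω)
    (hdisc : ∀ w ∈ Ω, ∃ φ : ℂ → Fin n → ℂ, DiffContOnCl ℂ φ (ball 0 1) ∧ φ 0 = w ∧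
      MapsTo φ (ball 0 1) Ω ∧ MapsTo φ (sphere 0 1) S)
    (hpeak : ∀ s ∈ S, ∃ g, IsInDomainAlgebra Ω g ∧ ∀ w ∈ closure Ω, w ≠ s → ‖g w‖ < ‖g s‖) :
    IsLeast (closedBoundaries Ω) S := by
  refine ⟨⟨hSΩ, hS.isClosed, fun g hg => ?_⟩, fun T hT s hs => ?_⟩
  · obtain ⟨z, hz, hmax⟩ := hS.exists_isMaxOn hne (hg.1.mono hSΩ).norm
    refine ⟨z, hz, fun w hw => ?_⟩
    have key : ∀ w ∈ Ω, ‖g w‖ ≤ ‖g z‖ := by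
      intro w hw
      obtain ⟨φ, hφ, h0, hb, hs⟩ := hdisc w hw
      have hcl : MapsTo φ (closure (ball 0 1)) (closure Ω) := by
        rw [closure_ball _ one_ne_zero, ← ball_union_sphere]
        rintro ζ (h | h)
        · exact subset_closure (hb h)
        · exact hSΩ (hs h)
      have hd : DiffContOnCl ℂ (g ∘ φ) (ball 0 1) :=
        ⟨hg.2.comp hφ.differentiableOn hb, hg.1.comp hφ.continuousOn hcl⟩
      have := Complex.norm_le_of_forall_mem_frontier_norm_le (C := ‖g z‖) isBounded_ball hd
        (fun ζ hζ => by
          rw [frontier_ball _ one_ne_zero] at hζ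
          exact hmax (hs hζ)) (subset_closure (mem_ball_self one_pos))
      simpa [h0] using this
    have hsub : closure Ω ⊆ {w | w ∈ closure Ω ∧ ‖g w‖ ∈ Iic ‖g z‖} := by
      refine closure_minimal (fun w hw => ⟨subset_closure hw, key w hw⟩) ?_
      exact hg.1.norm.preimage_isClosed_of_isClosed isClosed_closure isClosed_Iic
    exact (hsub hw).2
  · obtain ⟨g, hg, hlt⟩ := hpeak s hs
    obtain ⟨z, hz, hmax⟩ := hT.2.2 g hg
    by_cases h : z = s
    · exact h ▸ hz
    · exact absurd (hmax s (hSΩ hs)) (not_le.2 (hlt z (hT.1 hz) h))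

theorem shilovBoundary_eq_of_isLeast {n : ℕ} {Ω S : Set (Fin n → ℂ)}
    (h : IsLeast (closedBoundaries Ω) S) : shilovBoundary Ω = S :=
  h.csInf_eq

theorem closure_image_of_inverse {n : ℕ} {F G : (Fin n → ℂ) → Fin n → ℂ}
    (hGF : Function.LeftInverse G F) (hFG : Function.RightInverse G F)
    (hF : Differentiable ℂ F) (hG : Differentiable ℂ G) (Ω : Set (Fin n → ℂ)) :
    closure (F '' Ω) = F '' closure Ω :=
  ((Homeomorph.mk ⟨F, G, hGF, hFG⟩ hF.continuous hG.continuous).image_closure Ω).symm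

/-- Composition with `F` pulls the algebra of `F '' Ω` back into that of `Ω`, and the homeomorphism
`F` commutes with closures. -/
theorem image_mem_closedBoundaries {n : ℕ} {F G : (Fin n → ℂ) → Fin n → ℂ}
    (hGF : Function.LeftInverse G F) (hFG : Function.RightInverse G F)
    (hF : Differentiable ℂ F) (hG : Differentiable ℂ G) {Ω S : Set (Fin n → ℂ)}
    (hS : S ∈ closedBoundaries Ω) : F '' S ∈ closedBoundaries (F '' Ω) := by
  have hcl := closure_image_of_inverse hGF hFG hF hG
  refine ⟨?_, ?_, fun g hg => ?_⟩
  · rw [hcl]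
    exact image_mono hS.1
  · rw [← closure_eq_iff_isClosed, hcl, hS.2.1.closure_eq]
  · obtain ⟨z, hz, hmax⟩ := hS.2.2 (g ∘ F)
      ⟨hg.1.comp hF.continuous.continuousOn (by rw [hcl]; exact mapsTo_image _ _),
        hg.2.comp hF.differentiableOn (mapsTo_image _ _)⟩
    refine ⟨F z, mem_image_of_mem _ hz, ?_⟩
    rw [hcl]
    rintro _ ⟨w, hw, rfl⟩
    exact hmax w hw

theorem isLeast_closedBoundaries_image {n : ℕ} {F G : (Fin n → ℂ) → Fin n → ℂ}
    (hGF : Function.LeftInverse G F) (hFG : Function.RightInverse G F)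
    (hF : Differentiable ℂ F) (hG : Differentiable ℂ G) {Ω S : Set (Fin n → ℂ)}
    (h : IsLeast (closedBoundaries Ω) S) : IsLeast (closedBoundaries (F '' Ω)) (F '' S) := by
  refine ⟨image_mem_closedBoundaries hGF hFG hF hG h.1, fun T hT => ?_⟩
  have := image_mem_closedBoundaries hFG hGF hG hF hT
  rw [hGF.image_image] at this
  have h2 : F '' S ⊆ F '' (G '' T) := image_mono (h.2 this)
  rwa [hFG.image_image] at h2

/-! ### The squared Lie ball and its peak points -/

/-- The image of the Lie ball of `ℂ^(m+1)` under squaring the first coordinate. -/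
def lieSquare (m : ℕ) : Set (Fin (m + 1) → ℂ) :=
  {w | ‖w 0‖ + ∑ i : Fin m, ‖w i.succ‖ ^ 2 < 1 ∧
    2 * (‖w 0‖ + ∑ i : Fin m, ‖w i.succ‖ ^ 2) - ‖w 0 + ∑ i : Fin m, w i.succ ^ 2‖ ^ 2 < 1}

/-- The image of `{u x : |u| = 1, x ∈ ℝ^(m+1), ‖x‖ = 1}` under squaring the first coordinate. -/
def lieSquareBoundary (m : ℕ) : Set (Fin (m + 1) → ℂ) :=
  {w | ∃ u : ℂ, ‖u‖ = 1 ∧ ∃ x : Fin (m + 1) → ℝ, ∑ i, x i ^ 2 = 1 ∧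
    w = Fin.cons ((u * x 0) ^ 2) (fun i : Fin m => u * x i.succ)}

theorem isOpen_lieSquare (m : ℕ) : IsOpen (lieSquare m) := by
  rw [lieSquare, ofPred_and]
  exact (isOpen_lt (by fun_prop) (by fun_prop)).inter (isOpen_lt (by fun_prop) (by fun_prop))

theorem closure_lieSquare_subset (m : ℕ) :
    closure (lieSquare m) ⊆ {w | ‖w 0‖ + ∑ i : Fin m, ‖w i.succ‖ ^ 2 ≤ 1} :=
  closure_minimal (fun _ hw => hw.1.le) (isClosed_le (by fun_prop) (by fun_prop))

/-- Shrinking the real unit vector by r < 1 makes the second defining inequality read 2r² - r⁴ < 1,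
that is (1 - r²)² > 0. -/
theorem lieSquareBoundary_subset_closure (m : ℕ) :
    lieSquareBoundary m ⊆ closure (lieSquare m) := by
  rintro _ ⟨u, hu, x, hx, rfl⟩
  have hx' : x 0 ^ 2 + ∑ i : Fin m, x i.succ ^ 2 = 1 := by rw [← hx, Fin.sum_univ_succ]
  let ψ : ℝ → Fin (m + 1) → ℂ := fun r =>
    Fin.cons ((r * u * x 0) ^ 2) (fun i : Fin m => r * u * x i.succ)
  have hψ : Continuous ψ := by
    refine continuous_pi fun i => ?_
    refine Fin.cases ?_ (fun i => ?_) i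
    · simp only [ψ, Fin.cons_zero]; fun_prop
    · simp only [ψ, Fin.cons_succ]; fun_prop
  have h1 : ψ 1 = Fin.cons ((u * x 0) ^ 2) (fun i : Fin m => u * x i.succ) := by simp [ψ]
  rw [← h1]
  have hcl : (1 : ℝ) ∈ closure (Ioo (0 : ℝ) 1) := by
    rw [closure_Ioo zero_ne_one]; simp
  refine map_mem_closure hψ hcl fun r hr => ?_
  have hN : ‖ψ r 0‖ + ∑ i : Fin m, ‖ψ r i.succ‖ ^ 2 = r ^ 2 := by
    simp only [ψ, Fin.cons_zero, Fin.cons_succ, norm_mul, norm_pow, hu, norm_real,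
      Real.norm_eq_abs, mul_pow, sq_abs, one_pow, mul_one, ← Finset.mul_sum]
    rw [← mul_add, hx', mul_one]
  have hD : ψ r 0 + ∑ i : Fin m, ψ r i.succ ^ 2 = (r * u) ^ 2 := by
    simp only [ψ, Fin.cons_zero, Fin.cons_succ, mul_pow, ← Finset.mul_sum]
    rw [← mul_add]
    have : ((x 0 ^ 2 + ∑ i : Fin m, x i.succ ^ 2 : ℝ) : ℂ) = 1 := by rw [hx']; simp
    push_cast at this
    rw [this, mul_one]
  have hr2 : r ^ 2 < 1 := by nlinarith [hr.1, hr.2]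
  refine ⟨by rw [hN]; exact hr2, ?_⟩
  rw [hN, hD, norm_pow, norm_mul, hu, norm_real, Real.norm_eq_abs, mul_one, sq_abs]
  nlinarith [sq_nonneg (1 - r ^ 2), mul_pos (sub_pos.2 hr2) (sub_pos.2 hr2)]

theorem isCompact_lieSquareBoundary (m : ℕ) : IsCompact (lieSquareBoundary m) := by
  have hK := (isCompact_sphere (0 : ℂ) 1).prod
    (isCompact_sphere (0 : EuclideanSpace ℝ (Fin (m + 1))) 1)
  have hc : Continuous fun q : ℂ × EuclideanSpace ℝ (Fin (m + 1)) =>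
      (Fin.cons ((q.1 * q.2 0) ^ 2) (fun i : Fin m => q.1 * q.2 i.succ) : Fin (m + 1) → ℂ) := by
    refine continuous_pi fun i => ?_
    refine Fin.cases ?_ (fun i => ?_) i
    · simp only [Fin.cons_zero]; fun_prop
    · simp only [Fin.cons_succ]; fun_prop
  convert hK.image hc using 1
  ext w
  constructor
  · rintro ⟨u, hu, x, hx, rfl⟩
    refine ⟨(u, WithLp.toLp 2 x), ⟨by simpa using hu, ?_⟩, rfl⟩
    simp [EuclideanSpace.norm_eq, hx]
  · rintro ⟨⟨u, x⟩, ⟨hu, hx⟩, rfl⟩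
    refine ⟨u, by simpa using hu, x, ?_, rfl⟩
    simpa [EuclideanSpace.norm_eq] using hx

theorem lieSquareBoundary_nonempty (m : ℕ) : (lieSquareBoundary m).Nonempty :=
  ⟨_, 1, norm_one, Pi.single 0 1, by simp [Fin.sum_univ_succ], rfl⟩

/-- The sum-of-squares identity that makes the points of `lieSquareBoundary` peak points. -/
theorem one_add_sum_sub_re_eq {m : ℕ} (v : Fin (m + 1) → ℂ) (x : Fin m → ℝ) :
    1 + ∑ i, x i ^ 2 - (v 0 + 2 * ∑ i, x i * v i.succ).re =
      (1 - (‖v 0‖ + ∑ i : Fin m, ‖v i.succ‖ ^ 2)) + (‖v 0‖ - (v 0).re) +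
        ∑ i : Fin m, ‖v i.succ - x i‖ ^ 2 := by
  have h : ∀ i : Fin m, ‖v i.succ - x i‖ ^ 2 =
      ‖v i.succ‖ ^ 2 + x i ^ 2 - 2 * (x i * v i.succ).re := by
    intro i
    rw [← normSq_eq_norm_sq, ← normSq_eq_norm_sq, normSq_apply, normSq_apply]
    simp
    ring
  simp only [h, Finset.sum_sub_distrib, Finset.sum_add_distrib, ← Finset.mul_sum, add_re]
  have : (2 * ∑ i, x i * v i.succ).re = 2 * ∑ i, (x i * v i.succ).re := by
    simp [re_sum]
  rw [this]
  ring

/-- After rotation by u⁻¹, the three summands on the right of `one_add_sum_sub_re_eq` are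
nonnegative on the closure. Hence Re L is at most its value 1 + ∑ xᵢ² at `s`, and equality makes all
three vanish, which determines the point. The exponential turns the real part into a modulus. -/
theorem exists_peak_lieSquare {m : ℕ} {s : Fin (m + 1) → ℂ} (hs : s ∈ lieSquareBoundary m) :
    ∃ g, IsInDomainAlgebra (lieSquare m) g ∧
      ∀ w ∈ closure (lieSquare m), w ≠ s → ‖g w‖ < ‖g s‖ := by
  obtain ⟨u, hu, x, hx, hsx⟩ := hs
  have hu0 : u ≠ 0 := by rintro rfl; simp at hu
  have hx' : x 0 ^ 2 + ∑ i : Fin m, x i.succ ^ 2 = 1 := by rw [← hx, Fin.sum_univ_succ]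
  let R : (Fin (m + 1) → ℂ) → Fin (m + 1) → ℂ := fun w =>
    Fin.cons (w 0 / u ^ 2) (fun i : Fin m => w i.succ / u)
  let L : (Fin (m + 1) → ℂ) → ℂ := fun w =>
    w 0 / u ^ 2 + 2 * ∑ i : Fin m, x i.succ * (w i.succ / u)
  have hL : Differentiable ℂ fun w => exp (L w) := by
    simp only [L]; fun_prop
  refine ⟨fun w => exp (L w), ⟨hL.continuous.continuousOn, hL.differentiableOn⟩,
    fun w hw hne => ?_⟩
  have hN : ‖R w 0‖ + ∑ i : Fin m, ‖R w i.succ‖ ^ 2 ≤ 1 := by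
    simpa [R, hu] using closure_lieSquare_subset m hw
  have hid := one_add_sum_sub_re_eq (R w) (fun i => x i.succ)
  have hLs : L s = ((1 + ∑ i : Fin m, x i.succ ^ 2 : ℝ) : ℂ) := by
    simp only [L, hsx, Fin.cons_zero, Fin.cons_succ, mul_div_cancel_left₀ _ hu0, mul_pow]
    rw [mul_div_cancel_left₀ _ (pow_ne_zero 2 hu0), ← hx']
    push_cast
    simp only [← pow_two]
    ring
  have hLw : L w = R w 0 + 2 * ∑ i : Fin m, (x i.succ : ℂ) * R w i.succ := by
    simp [L, R]
  rw [norm_exp, norm_exp, Real.exp_lt_exp, hLs, ofReal_re, hLw]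
  by_contra hcon
  have hsum : 0 ≤ ∑ i : Fin m, ‖R w i.succ - x i.succ‖ ^ 2 :=
    Finset.sum_nonneg fun i _ => by positivity
  have hre := re_le_norm (R w 0)
  have hz : ∑ i : Fin m, ‖R w i.succ - x i.succ‖ ^ 2 = 0 := by linarith
  have h1 : ∀ i : Fin m, R w i.succ = x i.succ := by
    intro i
    have := (Finset.sum_eq_zero_iff_of_nonneg (fun i _ => by positivity)).1 hz i (Finset.mem_univ i)
    simpa [sub_eq_zero] using this
  have h2 : ‖R w 0‖ = x 0 ^ 2 := by
    have : ∑ i : Fin m, ‖R w i.succ‖ ^ 2 = ∑ i : Fin m, x i.succ ^ 2 := by simp [h1]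
    linarith
  have h3 : R w 0 = (x 0 : ℂ) ^ 2 := by
    have h4 : (R w 0).re = ‖R w 0‖ := by linarith
    have h5 := (re_eq_norm.1 h4)
    rw [Complex.nonneg_iff] at h5
    apply Complex.ext
    · rw [h4, h2]; norm_cast
    · rw [← h5.2]; norm_cast
  apply hne
  rw [hsx]
  ext i
  refine Fin.cases ?_ (fun i => ?_) i
  · simp only [R, Fin.cons_zero] at h3
    rw [Fin.cons_zero, mul_pow, ← h3, mul_div_cancel₀ _ (pow_ne_zero 2 hu0)]
  · have := h1 i
    simp only [R, Fin.cons_succ] at this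
    rw [Fin.cons_succ, ← this, mul_div_cancel₀ _ hu0]

/-! ### Complexified real planes and their bidiscs -/

theorem exists_unit_orthogonal {E : Type*} [NormedAddCommGroup E] [InnerProductSpace ℝ E]
    [FiniteDimensional ℝ E] (hE : 1 < Module.finrank ℝ E) (v : E) :
    ∃ e : E, ‖e‖ = 1 ∧ inner ℝ v e = 0 := by
  have hne : (ℝ ∙ v)ᗮ ≠ ⊥ := by
    intro h
    have h1 := Submodule.finrank_add_finrank_orthogonal (ℝ ∙ v)
    have h2 : Module.finrank ℝ (ℝ ∙ v) ≤ 1 := by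
      simpa using finrank_span_le_card (R := ℝ) ({v} : Set E)
    rw [h, finrank_bot] at h1
    omega
  obtain ⟨y, hy, hy0⟩ := Submodule.exists_mem_ne_zero_of_ne_bot hne
  refine ⟨‖y‖⁻¹ • y, ?_, ?_⟩
  · rw [norm_smul, norm_inv, norm_norm, inv_mul_cancel₀ (norm_ne_zero_iff.2 hy0)]
  · rw [inner_smul_right, Submodule.mem_orthogonal_singleton_iff_inner_right.1 hy, mul_zero]

/-- Nonzero vectors are normalised. The case split serves zero vectors, whose direction is free and
is chosen orthogonal to the other one. -/
theorem exists_orthonormal_pair {E : Type*} [NormedAddCommGroup E] [InnerProductSpace ℝ E]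
    [FiniteDimensional ℝ E] (hE : 1 < Module.finrank ℝ E) {a b : E} (hab : inner ℝ a b = 0) :
    ∃ e₁ e₂ : E, ‖e₁‖ = 1 ∧ ‖e₂‖ = 1 ∧ inner ℝ e₁ e₂ = 0 ∧ a = ‖a‖ • e₁ ∧ b = ‖b‖ • e₂ := by
  have key : ∀ c : E, c ≠ 0 → ∀ d : E, ‖c‖⁻¹ • c = d → ‖d‖ = 1 ∧ c = ‖c‖ • d := by
    rintro c hc d rfl
    exact ⟨by rw [norm_smul, norm_inv, norm_norm, inv_mul_cancel₀ (norm_ne_zero_iff.2 hc)],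
      by rw [smul_inv_smul₀ (norm_ne_zero_iff.2 hc)]⟩
  by_cases ha : a = 0
  · by_cases hb : b = 0
    · obtain ⟨e₁, he₁, -⟩ := exists_unit_orthogonal hE (0 : E)
      obtain ⟨e₂, he₂, h⟩ := exists_unit_orthogonal hE e₁
      exact ⟨e₁, e₂, he₁, he₂, h, by simp [ha], by simp [hb]⟩
    · obtain ⟨e₁, he₁, h⟩ := exists_unit_orthogonal hE b
      obtain ⟨h1, h2⟩ := key b hb _ rfl
      exact ⟨e₁, _, he₁, h1, by rw [inner_smul_right, real_inner_comm, h, mul_zero],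
        by simp [ha], h2⟩
  · obtain ⟨h1, h2⟩ := key a ha _ rfl
    by_cases hb : b = 0
    · obtain ⟨e₂, he₂, h⟩ := exists_unit_orthogonal hE a
      exact ⟨_, e₂, h1, he₂, by rw [inner_smul_left, h, mul_zero], h2, by simp [hb]⟩
    · obtain ⟨h3, h4⟩ := key b hb _ rfl
      exact ⟨_, _, h1, h3, by rw [inner_smul_left, inner_smul_right, hab, mul_zero, mul_zero],
        h2, h4⟩

theorem exists_unit_sq_eq (t : ℂ) : ∃ u : ℂ, ‖u‖ = 1 ∧ t = u ^ 2 * ‖t‖ := by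
  obtain ⟨u, hu⟩ := IsAlgClosed.exists_pow_nat_eq (exp (arg t * I)) (n := 2) two_pos
  refine ⟨u, ?_, ?_⟩
  · have h : ‖u‖ ^ 2 = 1 := by rw [← norm_pow, hu, norm_exp_ofReal_mul_I]
    exact (pow_eq_one_iff_of_nonneg (norm_nonneg u) two_ne_zero).1 h
  · rw [hu, mul_comm, norm_mul_exp_arg_mul_I]

/-- The polydisc of diagonal form through a point: `μ ↦ u ((μ₁ + μ₂)/2 e₁ + i (μ₁ - μ₂)/2 e₂)`. -/
noncomputable def spinPlane {m : ℕ} (u : ℂ) (e₁ e₂ : Fin m → ℝ) (μ₁ μ₂ : ℂ) (i : Fin m) : ℂ :=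
  u * ((μ₁ + μ₂) / 2 * e₁ i + I * ((μ₁ - μ₂) / 2) * e₂ i)

theorem sum_norm_spinPlane {m : ℕ} {u : ℂ} (hu : ‖u‖ = 1) {e₁ e₂ : Fin m → ℝ}
    (h₁ : ∑ i, e₁ i ^ 2 = 1) (h₂ : ∑ i, e₂ i ^ 2 = 1) (h₁₂ : ∑ i, e₁ i * e₂ i = 0) (μ₁ μ₂ : ℂ) :
    ∑ i, ‖spinPlane u e₁ e₂ μ₁ μ₂ i‖ ^ 2 = (‖μ₁‖ ^ 2 + ‖μ₂‖ ^ 2) / 2 := by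
  have h : ∀ i, ‖spinPlane u e₁ e₂ μ₁ μ₂ i‖ ^ 2 =
      normSq ((μ₁ + μ₂) / 2) * e₁ i ^ 2 + normSq ((μ₁ - μ₂) / 2) * e₂ i ^ 2 +
        2 * ((μ₁ + μ₂) / 2 * starRingEnd ℂ (I * ((μ₁ - μ₂) / 2))).re * (e₁ i * e₂ i) := by
    intro i
    rw [spinPlane, norm_mul, hu, one_mul, ← normSq_eq_norm_sq, normSq_add, normSq_mul, normSq_mul,
      normSq_mul, normSq_I, normSq_ofReal, normSq_ofReal, map_mul, conj_ofReal]
    rw [show (μ₁ + μ₂) / 2 * (e₁ i : ℂ) * (starRingEnd ℂ (I * ((μ₁ - μ₂) / 2)) * (e₂ i : ℂ)) =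
      ((e₁ i * e₂ i : ℝ) : ℂ) * ((μ₁ + μ₂) / 2 * starRingEnd ℂ (I * ((μ₁ - μ₂) / 2))) by
        push_cast; ring, re_ofReal_mul]
    ring
  simp only [h, Finset.sum_add_distrib, ← Finset.mul_sum, h₁, h₂, h₁₂]
  rw [← normSq_eq_norm_sq, ← normSq_eq_norm_sq]
  simp [normSq_apply]
  ring

theorem sum_sq_spinPlane {m : ℕ} {u : ℂ} {e₁ e₂ : Fin m → ℝ}
    (h₁ : ∑ i, e₁ i ^ 2 = 1) (h₂ : ∑ i, e₂ i ^ 2 = 1) (h₁₂ : ∑ i, e₁ i * e₂ i = 0) (μ₁ μ₂ : ℂ) :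
    ∑ i, spinPlane u e₁ e₂ μ₁ μ₂ i ^ 2 = u ^ 2 * (μ₁ * μ₂) := by
  have h : ∀ i, spinPlane u e₁ e₂ μ₁ μ₂ i ^ 2 =
      u ^ 2 * ((μ₁ + μ₂) / 2) ^ 2 * ((e₁ i ^ 2 : ℝ) : ℂ) -
      u ^ 2 * ((μ₁ - μ₂) / 2) ^ 2 * ((e₂ i ^ 2 : ℝ) : ℂ) +
      2 * u ^ 2 * I * ((μ₁ + μ₂) / 2) * ((μ₁ - μ₂) / 2) * ((e₁ i * e₂ i : ℝ) : ℂ) := by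
    intro i
    rw [spinPlane]
    push_cast
    linear_combination (u ^ 2 * ((μ₁ - μ₂) / 2) ^ 2 * (e₂ i : ℂ) ^ 2) * I_sq
  simp only [h, Finset.sum_add_distrib, Finset.sum_sub_distrib, ← Finset.mul_sum, ← ofReal_sum,
    h₁, h₂, h₁₂]
  push_cast
  ring

/-- Every vector of `ℂ^(m+2)` lies on a complexified plane, in real parameters. -/
theorem exists_eq_spinPlane {m : ℕ} (z : Fin (m + 2) → ℂ) :
    ∃ (u : ℂ) (e₁ e₂ : Fin (m + 2) → ℝ) (l₁ l₂ : ℝ), ‖u‖ = 1 ∧ ∑ i, e₁ i ^ 2 = 1 ∧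
      ∑ i, e₂ i ^ 2 = 1 ∧ ∑ i, e₁ i * e₂ i = 0 ∧ z = spinPlane u e₁ e₂ l₁ l₂ := by
  -- Dividing by a square root u of the phase of ∑ zᵢ² makes ∑ (zᵢ/u)² real. Its imaginary part is
  -- twice the inner product of Re(z/u) and Im(z/u), so these are orthogonal.
  obtain ⟨u, hu, ht⟩ := exists_unit_sq_eq (∑ i, z i ^ 2)
  have hu0 : u ≠ 0 := by rintro rfl; simp at hu
  let a : EuclideanSpace ℝ (Fin (m + 2)) := WithLp.toLp 2 fun i => (z i / u).re
  let b : EuclideanSpace ℝ (Fin (m + 2)) := WithLp.toLp 2 fun i => (z i / u).im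
  have hs : ∑ i, (z i / u) ^ 2 = ((‖∑ i, z i ^ 2‖ : ℝ) : ℂ) := by
    simp only [div_pow, ← Finset.sum_div]
    rw [div_eq_iff (pow_ne_zero 2 hu0), mul_comm, ← ht]
  have hab : inner ℝ a b = 0 := by
    have him := congrArg Complex.im hs
    rw [ofReal_im, im_sum] at him
    have h2 : ∀ i, ((z i / u) ^ 2).im = 2 * ((z i / u).re * (z i / u).im) := by
      intro i
      rw [pow_two, mul_im]
      ring
    simp only [h2, ← Finset.mul_sum] at him
    simp only [PiLp.inner_apply, a, b, RCLike.inner_apply, conj_trivial]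
    simp only [mul_comm] at him ⊢
    linarith
  obtain ⟨e₁, e₂, h₁, h₂, h₁₂, ha, hb⟩ := exists_orthonormal_pair (by simp) hab
  -- The half sum and half difference of the parameters must be ‖a‖ and ‖b‖.
  refine ⟨u, e₁, e₂, ‖a‖ + ‖b‖, ‖a‖ - ‖b‖, hu, ?_, ?_, ?_, ?_⟩
  · simpa [EuclideanSpace.norm_eq] using h₁
  · simpa [EuclideanSpace.norm_eq] using h₂
  · simpa [PiLp.inner_apply, mul_comm] using h₁₂
  · ext i
    have hai : (z i / u).re = ‖a‖ * e₁ i := by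
      have := congrArg (fun v : EuclideanSpace ℝ (Fin (m + 2)) => v i) ha
      simpa [a] using this
    have hbi : (z i / u).im = ‖b‖ * e₂ i := by
      have := congrArg (fun v : EuclideanSpace ℝ (Fin (m + 2)) => v i) hb
      simpa [b] using this
    have hz : z i = u * (z i / u) := (mul_div_cancel₀ _ hu0).symm
    rw [hz, ← re_add_im (z i / u), hai, hbi, spinPlane]
    push_cast
    ring

theorem mem_lieBall_spinPlane_iff {m : ℕ} {u : ℂ} (hu : ‖u‖ = 1) {e₁ e₂ : Fin m → ℝ}
    (h₁ : ∑ i, e₁ i ^ 2 = 1) (h₂ : ∑ i, e₂ i ^ 2 = 1) (h₁₂ : ∑ i, e₁ i * e₂ i = 0) (μ₁ μ₂ : ℂ) :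
    spinPlane u e₁ e₂ μ₁ μ₂ ∈ lieBall m ↔ ‖μ₁‖ < 1 ∧ ‖μ₂‖ < 1 := by
  simp only [lieBall, mem_ofPred_eq, sum_norm_spinPlane hu h₁ h₂ h₁₂, sum_sq_spinPlane h₁ h₂ h₁₂,
    norm_mul, norm_pow, hu]
  rw [← sq_lt_one_iff₀ (norm_nonneg μ₁), ← sq_lt_one_iff₀ (norm_nonneg μ₂)]
  generalize hp : ‖μ₁‖ = p
  generalize hq : ‖μ₂‖ = q
  -- The second Lie ball inequality factors as a product of the two disc conditions; the first rules
  -- out both factors being negative.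
  have e : 1 - (2 * ((p ^ 2 + q ^ 2) / 2) - (1 ^ 2 * (p * q)) ^ 2) = (1 - p ^ 2) * (1 - q ^ 2) := by
    ring
  constructor
  · rintro ⟨h, h'⟩
    have h3 : 0 < (1 - p ^ 2) * (1 - q ^ 2) := by rw [← e]; linarith
    rcases pos_and_pos_or_neg_and_neg_of_mul_pos h3 with h4 | h4
    · exact ⟨by linarith [h4.1], by linarith [h4.2]⟩
    · linarith [h4.1, h4.2]
  · rintro ⟨h, h'⟩
    have h3 : 0 < (1 - p ^ 2) * (1 - q ^ 2) := mul_pos (by linarith) (by linarith)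
    exact ⟨by linarith, by linarith⟩

/-- With v² = μ₁μ₂, both (μ₁ + μ₂)/(2v) and i(μ₁ - μ₂)/(2v) are fixed by conjugation, which is
inversion on the unit circle. So they are real, and their squares add up to μ₁μ₂/v² = 1. -/
theorem spinPlane_of_norm_eq_one {m : ℕ} {u : ℂ} (hu : ‖u‖ = 1) {e₁ e₂ : Fin m → ℝ}
    (h₁ : ∑ i, e₁ i ^ 2 = 1) (h₂ : ∑ i, e₂ i ^ 2 = 1) (h₁₂ : ∑ i, e₁ i * e₂ i = 0) {μ₁ μ₂ : ℂ}
    (hμ₁ : ‖μ₁‖ = 1) (hμ₂ : ‖μ₂‖ = 1) :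
    ∃ v : ℂ, ‖v‖ = 1 ∧ ∃ x : Fin m → ℝ, ∑ i, x i ^ 2 = 1 ∧
      ∀ i, spinPlane u e₁ e₂ μ₁ μ₂ i = v * x i := by
  obtain ⟨v, hv, hvv⟩ := exists_unit_sq_eq (μ₁ * μ₂)
  rw [norm_mul, hμ₁, hμ₂, mul_one, ofReal_one, mul_one] at hvv
  have hv0 : v ≠ 0 := by rintro rfl; simp at hv
  have hm1 : μ₁ ≠ 0 := by rintro rfl; simp at hμ₁
  have hm2 : μ₂ ≠ 0 := by rintro rfl; simp at hμ₂
  have cinv : ∀ {w : ℂ}, ‖w‖ = 1 → starRingEnd ℂ w = w⁻¹ := fun h => by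
    rw [inv_def, normSq_eq_norm_sq, h]; simp
  have hc : starRingEnd ℂ ((μ₁ + μ₂) / (2 * v)) = (μ₁ + μ₂) / (2 * v) := by
    simp only [map_div₀, map_add, map_mul, cinv hμ₁, cinv hμ₂, cinv hv, map_ofNat]
    field_simp
    rw [← hvv]; ring
  have hd : starRingEnd ℂ (I * (μ₁ - μ₂) / (2 * v)) = I * (μ₁ - μ₂) / (2 * v) := by
    simp only [map_div₀, map_sub, map_mul, cinv hμ₁, cinv hμ₂, cinv hv, map_ofNat, conj_I]
    field_simp
    rw [← hvv]; ring
  obtain ⟨c, hc⟩ := conj_eq_iff_real.1 hc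
  obtain ⟨d, hd⟩ := conj_eq_iff_real.1 hd
  rw [div_eq_iff (mul_ne_zero two_ne_zero hv0)] at hc hd
  have hcd : c ^ 2 + d ^ 2 = 1 := by
    have : ((c ^ 2 + d ^ 2 : ℝ) : ℂ) * (2 * v) ^ 2 = (2 * v) ^ 2 := by
      push_cast
      linear_combination (-(μ₁ + μ₂) - c * (2 * v)) * hc + (-(I * (μ₁ - μ₂)) - d * (2 * v)) * hd +
        (μ₁ - μ₂) ^ 2 * I_sq + 4 * hvv
    have h2 := mul_right_cancel₀ (pow_ne_zero 2 (mul_ne_zero two_ne_zero hv0))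
      (this.trans (one_mul _).symm)
    exact_mod_cast h2
  refine ⟨u * v, by rw [norm_mul, hu, hv, one_mul], fun i => c * e₁ i + d * e₂ i, ?_, fun i => ?_⟩
  · have : ∀ i, (c * e₁ i + d * e₂ i) ^ 2 =
        c ^ 2 * e₁ i ^ 2 + d ^ 2 * e₂ i ^ 2 + 2 * c * d * (e₁ i * e₂ i) := fun i => by ring
    simp only [this, Finset.sum_add_distrib, ← Finset.mul_sum, h₁, h₂, h₁₂]
    linarith
  · rw [spinPlane]
    push_cast
    linear_combination u * e₁ i / 2 * hc + u * e₂ i / 2 * hd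

/-! ### Analytic discs in the squared Lie ball -/

/-- The Möbius map of the unit disc taking `0` to `l`. -/
noncomputable def discShift (l : ℝ) (ζ : ℂ) : ℂ :=
  (l + ζ) / (1 + l * ζ)

theorem one_add_mul_ne_zero {l : ℝ} (hl : |l| < 1) {ζ : ℂ} (hζ : ‖ζ‖ ≤ 1) :
    1 + (l : ℂ) * ζ ≠ 0 := by
  intro h
  have h1 : ‖(l : ℂ) * ζ‖ = 1 := by rw [eq_neg_of_add_eq_zero_right h]; simp
  rw [norm_mul, norm_real, Real.norm_eq_abs] at h1
  nlinarith [abs_nonneg l, norm_nonneg ζ]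

theorem one_sub_norm_discShift {l : ℝ} (hl : |l| < 1) {ζ : ℂ} (hζ : ‖ζ‖ ≤ 1) :
    1 - ‖discShift l ζ‖ ^ 2 = (1 - l ^ 2) * (1 - ‖ζ‖ ^ 2) / ‖1 + (l : ℂ) * ζ‖ ^ 2 := by
  have h0 : ‖1 + (l : ℂ) * ζ‖ ^ 2 ≠ 0 := by simpa using one_add_mul_ne_zero hl hζ
  rw [discShift, norm_div, div_pow, eq_div_iff h0, sub_mul, div_mul_cancel₀ _ h0]
  simp only [← normSq_eq_norm_sq, normSq_apply]
  simp
  ring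

theorem norm_discShift_lt_one {l : ℝ} (hl : |l| < 1) {ζ : ℂ} (hζ : ‖ζ‖ < 1) :
    ‖discShift l ζ‖ < 1 := by
  rw [← sq_lt_one_iff₀ (norm_nonneg _), ← sub_pos, one_sub_norm_discShift hl hζ.le]
  have h1 : 0 < ‖1 + (l : ℂ) * ζ‖ := norm_pos_iff.2 (one_add_mul_ne_zero hl hζ.le)
  have h2 : l ^ 2 < 1 := (sq_lt_one_iff_abs_lt_one l).2 hl
  have h3 : ‖ζ‖ ^ 2 < 1 := (sq_lt_one_iff₀ (norm_nonneg _)).2 hζ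
  exact div_pos (mul_pos (by linarith) (by linarith)) (by positivity)

theorem norm_discShift_eq_one {l : ℝ} (hl : |l| < 1) {ζ : ℂ} (hζ : ‖ζ‖ = 1) :
    ‖discShift l ζ‖ = 1 := by
  have h := one_sub_norm_discShift hl hζ.le
  rw [hζ, one_pow, sub_self, mul_zero, zero_div, sub_eq_zero] at h
  exact (pow_eq_one_iff_of_nonneg (norm_nonneg _) two_ne_zero).1 h.symm

theorem diffContOnCl_discShift {l : ℝ} (hl : |l| < 1) :
    DiffContOnCl ℂ (discShift l) (ball 0 1) := by
  refine DifferentiableOn.diffContOnCl fun ζ hζ => ?_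
  rw [closure_ball _ one_ne_zero, mem_closedBall_zero_iff] at hζ
  have := one_add_mul_ne_zero hl hζ
  have h : DifferentiableAt ℂ (discShift l) ζ := by
    unfold discShift
    fun_prop (disch := assumption)
  exact h.differentiableWithinAt

/-- Squaring the first coordinate. -/
def squareFirst {m : ℕ} (z : Fin (m + 1) → ℂ) : Fin (m + 1) → ℂ :=
  Fin.cons (z 0 ^ 2) (fun i => z i.succ)

theorem squareFirst_mem_lieSquare_iff {m : ℕ} {z : Fin (m + 1) → ℂ} :
    squareFirst z ∈ lieSquare m ↔ z ∈ lieBall (m + 1) := by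
  simp [squareFirst, lieSquare, lieBall, Fin.sum_univ_succ]

theorem squareFirst_image_lieBall (m : ℕ) : squareFirst '' lieBall (m + 1) = lieSquare m := by
  ext w
  constructor
  · rintro ⟨z, hz, rfl⟩
    exact squareFirst_mem_lieSquare_iff.2 hz
  · intro hw
    obtain ⟨c, hc⟩ := IsAlgClosed.exists_pow_nat_eq (w 0) (n := 2) two_pos
    have h : squareFirst (Fin.cons c (fun i => w i.succ)) = w := by
      ext i
      refine Fin.cases ?_ (fun i => ?_) i <;> simp [squareFirst, hc]
    exact ⟨_, squareFirst_mem_lieSquare_iff.1 (h ▸ hw), h⟩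

theorem differentiable_squareFirst (m : ℕ) :
    Differentiable ℂ (squareFirst : (Fin (m + 1) → ℂ) → Fin (m + 1) → ℂ) := by
  refine differentiable_pi.2 fun i => ?_
  refine Fin.cases ?_ (fun i => ?_) i
  · simp only [squareFirst, Fin.cons_zero]; fun_prop
  · simp only [squareFirst, Fin.cons_succ]; fun_prop

theorem differentiable_squareFirst_spinPlane {m : ℕ} (u : ℂ) (e₁ e₂ : Fin (m + 1) → ℝ) :
    Differentiable ℂ fun q : ℂ × ℂ => squareFirst (spinPlane u e₁ e₂ q.1 q.2) := by
  have h : Differentiable ℂ fun q : ℂ × ℂ => spinPlane u e₁ e₂ q.1 q.2 := by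
    refine differentiable_pi.2 fun i => ?_
    simp only [spinPlane]
    fun_prop
  exact (differentiable_squareFirst m).comp h

theorem diffContOnCl_squareFirst_spinPlane {m : ℕ} (u : ℂ) (e₁ e₂ : Fin (m + 1) → ℝ)
    {f₁ f₂ : ℂ → ℂ} {U : Set ℂ} (h₁ : DiffContOnCl ℂ f₁ U) (h₂ : DiffContOnCl ℂ f₂ U) :
    DiffContOnCl ℂ (fun ζ => squareFirst (spinPlane u e₁ e₂ (f₁ ζ) (f₂ ζ))) U := by
  obtain ⟨F, hF⟩ : ∃ F : ℂ × ℂ → Fin (m + 1) → ℂ,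
      F = fun q => squareFirst (spinPlane u e₁ e₂ q.1 q.2) := ⟨_, rfl⟩
  have hd : Differentiable ℂ F := hF ▸ differentiable_squareFirst_spinPlane u e₁ e₂
  have h : (fun ζ => squareFirst (spinPlane u e₁ e₂ (f₁ ζ) (f₂ ζ))) =
      F ∘ fun ζ => (f₁ ζ, f₂ ζ) := by
    rw [hF]
    rfl
  rw [h]
  exact hd.comp_diffContOnCl ⟨h₁.1.prodMk h₂.1, h₁.2.prodMk h₂.2⟩

/-- In the bidisc through z, run the two Möbius maps with values l₁, l₂ at 0 simultaneously: they
send the disc into the bidisc and the circle into the torus. Dimension at least two is needed for an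
orthonormal pair. -/
theorem exists_disc_lieSquare {m : ℕ} {w : Fin (m + 2) → ℂ} (hw : w ∈ lieSquare (m + 1)) :
    ∃ φ : ℂ → Fin (m + 2) → ℂ, DiffContOnCl ℂ φ (ball 0 1) ∧ φ 0 = w ∧
      MapsTo φ (ball 0 1) (lieSquare (m + 1)) ∧
      MapsTo φ (sphere 0 1) (lieSquareBoundary (m + 1)) := by
  rw [← squareFirst_image_lieBall] at hw
  obtain ⟨z, hz, rfl⟩ := hw
  obtain ⟨u, e₁, e₂, l₁, l₂, hu, h₁, h₂, h₁₂, rfl⟩ := exists_eq_spinPlane z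
  rw [mem_lieBall_spinPlane_iff hu h₁ h₂ h₁₂, norm_real, norm_real, Real.norm_eq_abs,
    Real.norm_eq_abs] at hz
  obtain ⟨hl₁, hl₂⟩ := hz
  refine ⟨fun ζ => squareFirst (spinPlane u e₁ e₂ (discShift l₁ ζ) (discShift l₂ ζ)),
    ?_, by simp [discShift], fun ζ hζ => ?_, fun ζ hζ => ?_⟩
  · exact diffContOnCl_squareFirst_spinPlane u e₁ e₂ (diffContOnCl_discShift hl₁)
      (diffContOnCl_discShift hl₂)
  · rw [mem_ball_zero_iff] at hζ
    exact squareFirst_mem_lieSquare_iff.2 ((mem_lieBall_spinPlane_iff hu h₁ h₂ h₁₂ _ _).2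
      ⟨norm_discShift_lt_one hl₁ hζ, norm_discShift_lt_one hl₂ hζ⟩)
  · rw [mem_sphere_zero_iff_norm] at hζ
    obtain ⟨v, hv, x, hx, h⟩ := spinPlane_of_norm_eq_one hu h₁ h₂ h₁₂
      (norm_discShift_eq_one hl₁ hζ) (norm_discShift_eq_one hl₂ hζ)
    refine ⟨v, hv, x, hx, ?_⟩
    simp only [squareFirst, h]

theorem isLeast_closedBoundaries_lieSquare (m : ℕ) :
    IsLeast (closedBoundaries (lieSquare (m + 1))) (lieSquareBoundary (m + 1)) :=
  isLeast_closedBoundaries_of_discs_of_peaks (isCompact_lieSquareBoundary _)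
    (lieSquareBoundary_nonempty _) (lieSquareBoundary_subset_closure _)
    (fun _ hw => exists_disc_lieSquare hw) (fun _ hs => exists_peak_lieSquare hs)

/-! ### The unit ball of 2 × 2 matrices and 𝔽 -/

open scoped Matrix.Norms.L2Operator in
/-- The open unit ball of `2 × 2` matrices in terms of trace and determinant of `1 - AᴴA`. -/
theorem l2_opNorm_lt_one_iff (a b c d : ℂ) :
    ‖(!![a, b; c, d] : Matrix (Fin 2) (Fin 2) ℂ)‖ < 1 ↔
      ‖a‖ ^ 2 + ‖b‖ ^ 2 + ‖c‖ ^ 2 + ‖d‖ ^ 2 < 2 ∧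
        ‖a‖ ^ 2 + ‖b‖ ^ 2 + ‖c‖ ^ 2 + ‖d‖ ^ 2 - ‖a * d - b * c‖ ^ 2 < 1 := by
  set A : Matrix (Fin 2) (Fin 2) ℂ := !![a, b; c, d] with hA
  -- The Hermitian matrix 1 - AᴴA has diagonal p, r and upper right entry q; the claim is that it is
  -- positive definite exactly when its trace and determinant are positive.
  set p : ℝ := 1 - ‖a‖ ^ 2 - ‖c‖ ^ 2 with hp
  set r : ℝ := 1 - ‖b‖ ^ 2 - ‖d‖ ^ 2 with hr
  set q : ℂ := -(starRingEnd ℂ a * b + starRingEnd ℂ c * d) with hq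
  have hdet : p * r - ‖q‖ ^ 2 =
      1 - (‖a‖ ^ 2 + ‖b‖ ^ 2 + ‖c‖ ^ 2 + ‖d‖ ^ 2 - ‖a * d - b * c‖ ^ 2) := by
    simp only [hp, hr, hq, ← normSq_eq_norm_sq, normSq_apply]
    simp
    ring
  have hform : ∀ x y : ℂ, ‖x‖ ^ 2 + ‖y‖ ^ 2 - (‖a * x + b * y‖ ^ 2 + ‖c * x + d * y‖ ^ 2) =
      p * ‖x‖ ^ 2 + r * ‖y‖ ^ 2 + 2 * (q * starRingEnd ℂ x * y).re := by
    intro x y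
    simp only [hp, hr, hq, ← normSq_eq_norm_sq, normSq_apply]
    simp
    ring
  have hmul : ∀ v : EuclideanSpace ℂ (Fin 2), ‖Matrix.toEuclideanCLM (n := Fin 2) (𝕜 := ℂ) A v‖ ^ 2 =
      ‖a * v 0 + b * v 1‖ ^ 2 + ‖c * v 0 + d * v 1‖ ^ 2 := by
    intro v
    rw [EuclideanSpace.norm_sq_eq, Fin.sum_univ_two, Matrix.ofLp_toEuclideanCLM]
    simp [hA, Matrix.mulVec, dotProduct, Fin.sum_univ_two]
  have hnv : ∀ v : EuclideanSpace ℂ (Fin 2), ‖v‖ ^ 2 = ‖v 0‖ ^ 2 + ‖v 1‖ ^ 2 := fun v => by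
    rw [EuclideanSpace.norm_sq_eq, Fin.sum_univ_two]
  rw [Matrix.cstar_norm_def]
  constructor
  · intro h
    have hpos : ∀ x y : ℂ, 0 < ‖x‖ ^ 2 + ‖y‖ ^ 2 →
        0 < p * ‖x‖ ^ 2 + r * ‖y‖ ^ 2 + 2 * (q * starRingEnd ℂ x * y).re := by
      intro x y hxy
      let v : EuclideanSpace ℂ (Fin 2) := !₂[x, y]
      have hv : ‖v‖ ^ 2 = ‖x‖ ^ 2 + ‖y‖ ^ 2 := by simp [hnv, v]
      have h1 := (Matrix.toEuclideanCLM (n := Fin 2) (𝕜 := ℂ) A).le_opNorm v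
      have h2 : 0 < ‖v‖ := by
        rcases (norm_nonneg v).eq_or_lt with h0 | h0
        · rw [← hv, ← h0] at hxy; simp at hxy
        · exact h0
      have h3 : ‖Matrix.toEuclideanCLM (n := Fin 2) (𝕜 := ℂ) A v‖ < ‖v‖ :=
        h1.trans_lt (mul_lt_of_lt_one_left h2 h)
      have h4 := pow_lt_pow_left₀ h3 (norm_nonneg _) two_ne_zero
      rw [hmul, hv] at h4
      rw [← hform]
      simpa [v] using h4
    have hp0 : 0 < p := by simpa using hpos 1 0 (by simp)
    have hr0 : 0 < r := by simpa using hpos 0 1 (by simp)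
    have hp0' : 0 < ‖(p : ℂ)‖ := by simpa using hp0.ne'
    -- On the vector (-q, p) the form takes the value p(pr - |q|²).
    have h5 := hpos (-q) p (by positivity)
    have h6 : (q * starRingEnd ℂ (-q) * p).re = -(p * ‖q‖ ^ 2) := by
      rw [map_neg, mul_neg, mul_conj, normSq_eq_norm_sq, ← ofReal_neg, ← ofReal_mul, ofReal_re]
      ring
    rw [h6, norm_neg, norm_real, Real.norm_eq_abs, sq_abs] at h5
    have h7 : 0 < p * (p * r - ‖q‖ ^ 2) := by linarith
    have h8 := (pos_iff_pos_of_mul_pos h7).1 hp0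
    constructor <;> linarith
  · rintro ⟨h1, h2⟩
    have hD : 0 < p * r - ‖q‖ ^ 2 := by rw [hdet]; linarith
    have hT : 0 < p + r := by linarith
    -- Cayley–Hamilton for M = 1 - AᴴA: tr(M)·M - det(M) = M², so the difference of the two sides is
    -- ‖Mv‖². This bounds the form below by ε = det/tr times ‖v‖², giving a norm strictly below 1.
    have hlow : ∀ x y : ℂ, (p * r - ‖q‖ ^ 2) * (‖x‖ ^ 2 + ‖y‖ ^ 2) ≤
        (p + r) * (p * ‖x‖ ^ 2 + r * ‖y‖ ^ 2 + 2 * (q * starRingEnd ℂ x * y).re) := by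
      intro x y
      have : (p + r) * (p * ‖x‖ ^ 2 + r * ‖y‖ ^ 2 + 2 * (q * starRingEnd ℂ x * y).re) -
          (p * r - ‖q‖ ^ 2) * (‖x‖ ^ 2 + ‖y‖ ^ 2) =
          ‖p * x + q * y‖ ^ 2 + ‖starRingEnd ℂ q * x + r * y‖ ^ 2 := by
        clear_value p q r
        simp only [← normSq_eq_norm_sq, normSq_apply]
        simp
        ring
      have h3 : 0 ≤ ‖p * x + q * y‖ ^ 2 + ‖starRingEnd ℂ q * x + r * y‖ ^ 2 := by positivity
      linarith
    set ε := (p * r - ‖q‖ ^ 2) / (p + r) with hε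
    have hε0 : 0 < ε := div_pos hD hT
    have hbound : ∀ v, ‖Matrix.toEuclideanCLM (n := Fin 2) (𝕜 := ℂ) A v‖ ≤ √(1 - ε) * ‖v‖ := by
      intro v
      have h3 := hlow (v 0) (v 1)
      rw [← hform, ← hmul, ← hnv] at h3
      have h4 : ‖Matrix.toEuclideanCLM (n := Fin 2) (𝕜 := ℂ) A v‖ ^ 2 ≤ (1 - ε) * ‖v‖ ^ 2 := by
        have h5 : ε * ‖v‖ ^ 2 ≤ ‖v‖ ^ 2 - ‖Matrix.toEuclideanCLM (n := Fin 2) (𝕜 := ℂ) A v‖ ^ 2 := by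
          rw [hε, div_mul_eq_mul_div, div_le_iff₀ hT]
          linarith
        linarith
      have h6 := Real.sqrt_le_sqrt h4
      rwa [Real.sqrt_sq (norm_nonneg _), Real.sqrt_mul' _ (sq_nonneg _),
        Real.sqrt_sq (norm_nonneg _)] at h6
    refine (ContinuousLinearMap.opNorm_le_bound _ (Real.sqrt_nonneg _) hbound).trans_lt ?_
    rw [Real.sqrt_lt' one_pos]
    linarith

/-- The linear isomorphism from `ℂ⁴` onto the `2 × 2` matrices taking the Lie ball to the unit
ball. -/
def spinMatrix (z : Fin 4 → ℂ) : Matrix (Fin 2) (Fin 2) ℂ :=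
  !![z 2 + I * z 3, z 1 + I * z 0; z 1 - I * z 0, -z 2 + I * z 3]

open scoped Matrix.Norms.L2Operator in
-- The squared entries of `spinMatrix z` sum to 2‖z‖² and its determinant is -∑ zᵢ², so the two
-- matrix conditions become those of the Lie ball.
theorem norm_spinMatrix_lt_one_iff (z : Fin 4 → ℂ) : ‖spinMatrix z‖ < 1 ↔ z ∈ lieBall 4 := by
  rw [spinMatrix, l2_opNorm_lt_one_iff]
  have h1 : ‖z 2 + I * z 3‖ ^ 2 + ‖z 1 + I * z 0‖ ^ 2 + ‖z 1 - I * z 0‖ ^ 2 +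
      ‖-z 2 + I * z 3‖ ^ 2 = 2 * ∑ i, ‖z i‖ ^ 2 := by
    simp only [Fin.sum_univ_four, ← normSq_eq_norm_sq, normSq_apply]
    simp
    ring
  have h2 : (z 2 + I * z 3) * (-z 2 + I * z 3) - (z 1 + I * z 0) * (z 1 - I * z 0) =
      -∑ i, z i ^ 2 := by
    rw [Fin.sum_univ_four]
    linear_combination (z 3 ^ 2 + z 0 ^ 2) * I_sq
  rw [h1, h2, norm_neg, lieBall, mem_ofPred_eq]
  exact and_congr_left' ⟨fun h => by linarith, fun h => by linarith⟩

theorem surjective_spinMatrix : Function.Surjective spinMatrix := fun A => by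
  refine ⟨![-I * (A 0 1 - A 1 0) / 2, (A 0 1 + A 1 0) / 2, (A 0 0 - A 1 1) / 2,
    -I * (A 0 0 + A 1 1) / 2], ?_⟩
  ext i j
  fin_cases i <;> fin_cases j <;> simp [spinMatrix] <;> ring_nf <;> simp <;> ring

theorem Lambda4_eq_squareFirst : Lambda4 = squareFirst := by
  ext z i
  fin_cases i <;> rfl

theorem domainL4_eq_lieSquare : domainL4 = lieSquare 3 := by
  rw [domainL4, Lambda4_eq_squareFirst, squareFirst_image_lieBall]

/-- The coordinate z₀ cancels from the off-diagonal sum and enters the determinant only as z₀²,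
which is why squaring it loses nothing. -/
theorem piF_spinMatrix (z : Fin 4 → ℂ) : piF (spinMatrix z) = mapF (squareFirst z) := by
  have h0 : squareFirst z = ![z 0 ^ 2, z 1, z 2, z 3] := by
    ext i
    fin_cases i <;> rfl
  rw [h0]
  ext i
  fin_cases i <;> simp [piF, spinMatrix, mapF, Matrix.det_fin_two] <;> ring_nf <;> simp <;> ring

open scoped Matrix.Norms.L2Operator in
theorem domainF_eq_image_lieSquare : domainF = mapF '' lieSquare 3 := by
  rw [← squareFirst_image_lieBall, image_image]
  ext y
  constructor
  · rintro ⟨A, hA, rfl⟩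
    obtain ⟨z, rfl⟩ := surjective_spinMatrix A
    exact ⟨z, (norm_spinMatrix_lt_one_iff z).1 hA, (piF_spinMatrix z).symm⟩
  · rintro ⟨z, hz, rfl⟩
    exact ⟨_, (norm_spinMatrix_lt_one_iff z).2 hz, piF_spinMatrix z⟩

/-- The inverse of `mapF`. -/
noncomputable def mapFInv (y : Fin 4 → ℂ) : Fin 4 → ℂ :=
  ![-y 2 - (y 3 / 2) ^ 2 - y 0 ^ 2 / 4 + y 0 * y 1 / 2 - y 1 ^ 2 / 4 + (y 0 + y 1) ^ 2 / 4,
    y 3 / 2, (y 0 - y 1) / 2, -I * (y 0 + y 1) / 2]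

theorem leftInverse_mapFInv : Function.LeftInverse mapFInv mapF := fun w => by
  ext i
  fin_cases i <;> simp [mapFInv, mapF] <;> ring_nf <;> simp

theorem rightInverse_mapFInv : Function.RightInverse mapFInv mapF := fun w => by
  ext i
  fin_cases i <;> simp [mapFInv, mapF] <;> ring_nf <;> simp <;> ring

theorem differentiable_mapF : Differentiable ℂ mapF := by
  refine differentiable_pi.2 fun i => ?_
  fin_cases i <;> simp [mapF] <;> fun_prop

theorem differentiable_mapFInv : Differentiable ℂ mapFInv := by
  refine differentiable_pi.2 fun i => ?_
  fin_cases i <;> simp [mapFInv] <;> fun_prop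

theorem isBiholomorphismOn_mapF : IsBiholomorphismOn mapF domainL4 domainF := by
  rw [domainL4_eq_lieSquare, domainF_eq_image_lieSquare]
  refine ⟨isOpen_lieSquare 3, ?_, leftInverse_mapFInv.injective.injOn.bijOn_image,
    differentiable_mapF.differentiableOn, mapFInv,
    ⟨leftInverse_mapFInv.leftInvOn _, rightInverse_mapFInv.leftInvOn _⟩,
    differentiable_mapFInv.differentiableOn⟩
  rw [image_eq_preimage_of_inverse leftInverse_mapFInv rightInverse_mapFInv]
  exact (isOpen_lieSquare 3).preimage differentiable_mapFInv.continuous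

/-! ### The tetrablock -/

/-- The polynomial automorphism of `ℂ³` taking `lieSquare 2` onto the tetrablock. -/
noncomputable def mapE (w : Fin 3 → ℂ) : Fin 3 → ℂ :=
  ![w 1 + I * w 2, -w 1 + I * w 2, -w 1 ^ 2 - w 2 ^ 2 - w 0]

/-- The inverse of `mapE`. -/
noncomputable def mapEInv (y : Fin 3 → ℂ) : Fin 3 → ℂ :=
  ![y 0 * y 1 - y 2, (y 0 - y 1) / 2, -I * (y 0 + y 1) / 2]

theorem leftInverse_mapEInv : Function.LeftInverse mapEInv mapE := fun w => by
  ext i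
  fin_cases i <;> simp [mapEInv, mapE] <;> ring_nf <;> simp

theorem rightInverse_mapEInv : Function.RightInverse mapEInv mapE := fun w => by
  ext i
  fin_cases i <;> simp [mapEInv, mapE] <;> ring_nf <;> simp <;> ring

theorem differentiable_mapE : Differentiable ℂ mapE := by
  refine differentiable_pi.2 fun i => ?_
  fin_cases i <;> simp [mapE] <;> fun_prop

theorem differentiable_mapEInv : Differentiable ℂ mapEInv := by
  refine differentiable_pi.2 fun i => ?_
  fin_cases i <;> simp [mapEInv] <;> fun_prop

/-- For fixed z the defining polynomial is affine in the other variable; if the inequality failed,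
its root would lie in the closed disc. -/
theorem norm_lt_of_mem_tetrablock {x : Fin 3 → ℂ} (hx : x ∈ tetrablock) {z : ℂ} (hz : ‖z‖ ≤ 1) :
    ‖x 1 - x 2 * z‖ < ‖1 - x 0 * z‖ := by
  by_contra! hcon
  have h0 : 1 - x 0 * z ≠ 0 := by simpa using hx z 0 hz (by simp)
  have h1 : 0 < ‖x 1 - x 2 * z‖ := (norm_pos_iff.2 h0).trans_le hcon
  refine hx z ((1 - x 0 * z) / (x 1 - x 2 * z)) hz ?_ ?_
  · rw [norm_div]
    exact (div_le_one h1).2 hcon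
  · linear_combination -div_mul_cancel₀ (1 - x 0 * z) (norm_pos_iff.1 h1)

theorem norm_lt_one_of_mem_tetrablock {x : Fin 3 → ℂ} (hx : x ∈ tetrablock) : ‖x 0‖ < 1 := by
  by_contra! h
  have h0 : x 0 ≠ 0 := by
    intro h0
    rw [h0, norm_zero] at h
    linarith
  refine hx (x 0)⁻¹ 0 ?_ (by simp) (by simp [h0])
  rw [norm_inv]
  exact inv_le_one_of_one_le₀ h

/-- Square `norm_lt_of_mem_tetrablock` at the unimodular z that makes the cross term real and
nonnegative. -/
theorem two_mul_norm_lt_of_mem_tetrablock {x : Fin 3 → ℂ} (hx : x ∈ tetrablock) :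
    2 * ‖x 0 - starRingEnd ℂ (x 1) * x 2‖ < 1 + ‖x 0‖ ^ 2 - ‖x 1‖ ^ 2 - ‖x 2‖ ^ 2 := by
  obtain ⟨u, hu, hut⟩ : ∃ u : ℂ, ‖u‖ = 1 ∧ (x 0 - starRingEnd ℂ (x 1) * x 2) * u =
      ‖x 0 - starRingEnd ℂ (x 1) * x 2‖ := by
    refine ⟨exp ((-arg (x 0 - starRingEnd ℂ (x 1) * x 2) : ℝ) * I), norm_exp_ofReal_mul_I _, ?_⟩
    nth_rewrite 1 [← norm_mul_exp_arg_mul_I (x 0 - starRingEnd ℂ (x 1) * x 2)]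
    rw [mul_assoc, ← exp_add]
    simp
  have h := pow_lt_pow_left₀ (norm_lt_of_mem_tetrablock hx hu.le) (norm_nonneg _) two_ne_zero
  have hre := congrArg Complex.re hut
  have hu2 : u.re * u.re + u.im * u.im = 1 := by
    rw [← normSq_apply, normSq_eq_norm_sq, hu, one_pow]
  rw [ofReal_re] at hre
  rw [← hre]
  have key : 2 * ((x 0 - starRingEnd ℂ (x 1) * x 2) * u).re =
      ‖x 1 - x 2 * u‖ ^ 2 - ‖1 - x 0 * u‖ ^ 2 + 1 + ‖x 0‖ ^ 2 * (u.re * u.re + u.im * u.im) -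
        ‖x 1‖ ^ 2 - ‖x 2‖ ^ 2 * (u.re * u.re + u.im * u.im) := by
    simp only [← normSq_eq_norm_sq, normSq_apply]
    simp
    ring
  rw [key, hu2]
  linarith

theorem swap_mem_tetrablock {x : Fin 3 → ℂ} (hx : x ∈ tetrablock) :
    ![x 1, x 0, x 2] ∈ tetrablock := by
  intro z₁ z₂ h₁ h₂ h
  refine hx z₂ z₁ h₂ h₁ ?_
  rw [← h]
  simp
  ring

/-- Here P, Q, R are the moduli of x₀, x₁, x₂, while M = |x₀ - x̄₁x₂|, N = |x₁ - x̄₀x₂| and c =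
|x₀x₁ - x₂|. By `hMc`, (1 - P² - Q² + R²)² - 4c² = (1 + P² - Q² - R²)² - 4M² > 0, so what remains is
the sign of 1 - P² - Q² + R². -/
theorem two_mul_lt_of_tetrablock_inequalities {P Q R M N c : ℝ} (hP1 : P < 1)
    (hQ : 0 ≤ Q) (hQ1 : Q < 1) (hP : 0 ≤ P) (hM : P - Q * R ≤ M)
    (hN : Q - P * R ≤ N) (hMc : M ^ 2 - c ^ 2 = (P ^ 2 - R ^ 2) * (1 - Q ^ 2)) (hM0 : 0 ≤ M)
    (hM2 : 2 * M < 1 + P ^ 2 - Q ^ 2 - R ^ 2) (hN0 : 0 ≤ N)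
    (hN2 : 2 * N < 1 + Q ^ 2 - P ^ 2 - R ^ 2) :
    2 * c < 1 - P ^ 2 - Q ^ 2 + R ^ 2 ∧ R ^ 2 < 1 := by
  have hR1 : R ^ 2 < 1 := by linarith
  have h1 : (Q - R) ^ 2 < (1 - P) ^ 2 := by linarith
  have h2 : |Q - R| < 1 - P := abs_lt_of_sq_lt_sq h1 (by linarith)
  have h3 : P + Q - 1 < R := by linarith [(abs_lt.1 h2).2]
  have hpos : 0 < 1 - P ^ 2 - Q ^ 2 + R ^ 2 := by
    rcases le_or_gt (P + Q) 1 with h | h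
    · by_cases h0 : P = 0
      · subst h0
        nlinarith [sq_nonneg R]
      · have : 0 < P := lt_of_le_of_ne hP (Ne.symm h0)
        nlinarith [sq_nonneg R, mul_nonneg hP hQ]
    -- Replacing R² by the smaller (P + Q - 1)² leaves 2(1 - P)(1 - Q) > 0.
    · have h4 : (P + Q - 1) ^ 2 < R ^ 2 := pow_lt_pow_left₀ h3 (by linarith) two_ne_zero
      nlinarith [mul_pos (sub_pos.2 hP1) (sub_pos.2 hQ1)]
  refine ⟨?_, hR1⟩
  have h5 : (2 * M) ^ 2 < (1 + P ^ 2 - Q ^ 2 - R ^ 2) ^ 2 :=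
    pow_lt_pow_left₀ hM2 (by linarith) two_ne_zero
  refine lt_of_pow_lt_pow_left₀ 2 hpos.le ?_
  linarith

/-- At `mapEInv x` the second inequality of `lieSquare 2` is 2|x₀x₁ - x₂| < 1 - |x₀|² - |x₁|² +
|x₂|²; together with |x₂| < 1 it implies the first. -/
theorem mapEInv_mem_lieSquare {x : Fin 3 → ℂ} (hx : x ∈ tetrablock) : mapEInv x ∈ lieSquare 2 := by
  have hM := two_mul_norm_lt_of_mem_tetrablock hx
  have hN := two_mul_norm_lt_of_mem_tetrablock (swap_mem_tetrablock hx)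
  have hP := norm_lt_one_of_mem_tetrablock hx
  have hQ := norm_lt_one_of_mem_tetrablock (swap_mem_tetrablock hx)
  simp only [Matrix.cons_val] at hN hQ
  have hM' := norm_sub_norm_le (x 0) (starRingEnd ℂ (x 1) * x 2)
  have hN' := norm_sub_norm_le (x 1) (starRingEnd ℂ (x 0) * x 2)
  rw [norm_mul, RCLike.norm_conj] at hM' hN'
  have hMc : ‖x 0 - starRingEnd ℂ (x 1) * x 2‖ ^ 2 - ‖x 0 * x 1 - x 2‖ ^ 2 =
      (‖x 0‖ ^ 2 - ‖x 2‖ ^ 2) * (1 - ‖x 1‖ ^ 2) := by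
    simp only [← normSq_eq_norm_sq, normSq_apply]
    simp
    ring
  obtain ⟨h1, h2⟩ := two_mul_lt_of_tetrablock_inequalities hP (norm_nonneg _) hQ
    (norm_nonneg _) hM' hN' hMc (norm_nonneg _) hM
    (norm_nonneg _) hN
  have e1 : ‖mapEInv x 0‖ + ∑ i : Fin 2, ‖mapEInv x i.succ‖ ^ 2 =
      ‖x 0 * x 1 - x 2‖ + (‖x 0‖ ^ 2 + ‖x 1‖ ^ 2) / 2 := by
    rw [Fin.sum_univ_two]
    have h3 : ‖mapEInv x (Fin.succ 0)‖ ^ 2 + ‖mapEInv x (Fin.succ 1)‖ ^ 2 =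
        (‖x 0‖ ^ 2 + ‖x 1‖ ^ 2) / 2 := by
      simp only [← normSq_eq_norm_sq, normSq_apply]
      simp [mapEInv]
      ring
    rw [h3]
    simp [mapEInv]
  have e2 : mapEInv x 0 + ∑ i : Fin 2, mapEInv x i.succ ^ 2 = -x 2 := by
    rw [Fin.sum_univ_two]
    simp [mapEInv]
    linear_combination (x 0 + x 1) ^ 2 / 4 * I_sq
  refine ⟨?_, ?_⟩
  · rw [e1]
    linarith
  · rw [e1, e2, norm_neg]
    linarith

open scoped Matrix.Norms.L2Operator in
-- The defining polynomial is det(1 - A·diag(z₁, z₂)), and ‖A·diag(z₁, z₂)‖ < 1 makes that matrix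
-- invertible.
theorem mem_tetrablock_of_norm_lt_one {A : Matrix (Fin 2) (Fin 2) ℂ} (hA : ‖A‖ < 1) :
    ![A 0 0, A 1 1, A.det] ∈ tetrablock := by
  intro z₁ z₂ h₁ h₂ h
  have hD : ‖(Matrix.diagonal ![z₁, z₂] : Matrix (Fin 2) (Fin 2) ℂ)‖ ≤ 1 := by
    rw [Matrix.l2_opNorm_diagonal, pi_norm_le_iff_of_nonneg zero_le_one]
    intro i
    fin_cases i
    · exact h₁
    · exact h₂
  have hAD : ‖A * Matrix.diagonal ![z₁, z₂]‖ < 1 :=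
    (norm_mul_le _ _).trans_lt ((mul_le_of_le_one_right (norm_nonneg _) hD).trans_lt hA)
  have hu := (Matrix.isUnit_iff_isUnit_det _).1 (isUnit_one_sub_of_norm_lt_one hAD)
  refine hu.ne_zero ?_
  rw [← h]
  simp [Matrix.det_fin_two, Matrix.mul_apply, Fin.sum_univ_two]
  ring

theorem tetrablock_eq_image_lieSquare : tetrablock = mapE '' lieSquare 2 := by
  ext x
  constructor
  · intro hx
    exact ⟨_, mapEInv_mem_lieSquare hx, rightInverse_mapEInv x⟩
  · rintro ⟨w, hw, rfl⟩
    rw [← squareFirst_image_lieBall] at hw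
    obtain ⟨z, hz, rfl⟩ := hw
    -- Padding by a zero coordinate puts the Lie ball of ℂ³ inside that of ℂ⁴; the corresponding
    -- contractions are symmetric.
    have hz' : ![0, z 0, z 1, z 2] ∈ lieBall 4 := by
      simpa [lieBall, Fin.sum_univ_succ] using hz
    have := mem_tetrablock_of_norm_lt_one ((norm_spinMatrix_lt_one_iff _).2 hz')
    convert this using 1
    have h0 : squareFirst z = ![z 0 ^ 2, z 1, z 2] := by
      ext i
      fin_cases i <;> rfl
    rw [h0]
    ext i
    fin_cases i <;> simp [spinMatrix, mapE, Matrix.det_fin_two] <;> ring_nf <;> simp <;> ring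

/-! ### The three Shilov boundaries and their parametrisations -/

theorem isLeast_closedBoundaries_domainL4 :
    IsLeast (closedBoundaries domainL4) (lieSquareBoundary 3) :=
  domainL4_eq_lieSquare ▸ isLeast_closedBoundaries_lieSquare 2

theorem isLeast_closedBoundaries_domainF :
    IsLeast (closedBoundaries domainF) (mapF '' lieSquareBoundary 3) :=
  domainF_eq_image_lieSquare ▸ isLeast_closedBoundaries_image leftInverse_mapFInv
    rightInverse_mapFInv differentiable_mapF differentiable_mapFInv
    (isLeast_closedBoundaries_lieSquare 2)

theorem isLeast_closedBoundaries_tetrablock :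
    IsLeast (closedBoundaries tetrablock) (mapE '' lieSquareBoundary 2) :=
  tetrablock_eq_image_lieSquare ▸ isLeast_closedBoundaries_image leftInverse_mapEInv
    rightInverse_mapEInv differentiable_mapE differentiable_mapEInv
    (isLeast_closedBoundaries_lieSquare 1)

theorem mem_image_mapF_lieSquareBoundary_iff (x a p s : ℂ) :
    ![x, a, p, s] ∈ mapF '' lieSquareBoundary 3 ↔
      ∃ u : ℂ, ‖u‖ = 1 ∧ ∃ x₁ x₂ x₃ x₄ : ℝ, x₁ ^ 2 + x₂ ^ 2 + x₃ ^ 2 + x₄ ^ 2 = 1 ∧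
        x = u * (x₃ + I * x₄) ∧ a = -(u * (x₃ - I * x₄)) ∧ p = -u ^ 2 ∧ s = 2 * u * x₂ := by
  have key : ∀ (u : ℂ) (y : Fin 4 → ℝ), ∑ i, y i ^ 2 = 1 →
      mapF (Fin.cons ((u * y 0) ^ 2) (fun i : Fin 3 => u * y i.succ)) =
        ![u * (y 2 + I * y 3), -(u * (y 2 - I * y 3)), -u ^ 2, 2 * u * y 1] := by
    intro u y hy
    have hy' : (y 0 : ℂ) ^ 2 + y 1 ^ 2 + y 2 ^ 2 + y 3 ^ 2 = 1 := by
      rw [Fin.sum_univ_four] at hy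
      exact_mod_cast hy
    have h0 : (Fin.cons ((u * y 0) ^ 2) (fun i : Fin 3 => u * y i.succ) : Fin 4 → ℂ) =
        ![(u * y 0) ^ 2, u * y 1, u * y 2, u * y 3] := by
      ext i
      fin_cases i <;> rfl
    rw [h0]
    ext i
    fin_cases i
    · simp [mapF]; ring
    · simp [mapF]; ring
    · simp [mapF]
      linear_combination -u ^ 2 * hy'
    · simp [mapF]; ring
  constructor
  · rintro ⟨_, ⟨u, hu, y, hy, rfl⟩, h⟩
    rw [key u y hy] at h
    refine ⟨u, hu, y 0, y 1, y 2, y 3, by rw [← Fin.sum_univ_four fun i => y i ^ 2, hy], ?_⟩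
    exact ⟨(congrFun h 0).symm, (congrFun h 1).symm, (congrFun h 2).symm, (congrFun h 3).symm⟩
  · rintro ⟨u, hu, x₁, x₂, x₃, x₄, hx, rfl, rfl, rfl, rfl⟩
    have hy : ∑ i, (![x₁, x₂, x₃, x₄] : Fin 4 → ℝ) i ^ 2 = 1 := by simpa [Fin.sum_univ_four] using hx
    exact ⟨_, ⟨u, hu, _, hy, rfl⟩, key u _ hy⟩

theorem mem_image_mapE_lieSquareBoundary_iff (x a p : ℂ) :
    ![x, a, p] ∈ mapE '' lieSquareBoundary 2 ↔
      ‖p‖ = 1 ∧ ‖x‖ ≤ 1 ∧ a = p * starRingEnd ℂ x := by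
  have key : ∀ (u : ℂ) (y : Fin 3 → ℝ), ∑ i, y i ^ 2 = 1 →
      mapE (Fin.cons ((u * y 0) ^ 2) (fun i : Fin 2 => u * y i.succ)) =
        ![u * (y 1 + I * y 2), -(u * (y 1 - I * y 2)), -u ^ 2] := by
    intro u y hy
    have hy' : (y 0 : ℂ) ^ 2 + y 1 ^ 2 + y 2 ^ 2 = 1 := by
      rw [Fin.sum_univ_three] at hy
      exact_mod_cast hy
    have h0 : (Fin.cons ((u * y 0) ^ 2) (fun i : Fin 2 => u * y i.succ) : Fin 3 → ℂ) =
        ![(u * y 0) ^ 2, u * y 1, u * y 2] := by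
      ext i
      fin_cases i <;> rfl
    rw [h0]
    ext i
    fin_cases i
    · simp [mapE]; ring
    · simp [mapE]; ring
    · simp [mapE]
      linear_combination -u ^ 2 * hy'
  constructor
  · rintro ⟨_, ⟨u, hu, y, hy, rfl⟩, h⟩
    rw [key u y hy] at h
    have hx : u * (y 1 + I * y 2) = x := congrFun h 0
    have ha : -(u * (y 1 - I * y 2)) = a := congrFun h 1
    have hp : -u ^ 2 = p := congrFun h 2
    have huu : u * starRingEnd ℂ u = 1 := by rw [mul_conj, normSq_eq_norm_sq, hu]; simp
    refine ⟨by rw [← hp, norm_neg, norm_pow, hu, one_pow], ?_, ?_⟩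
    · rw [← hx, norm_mul, hu, one_mul, ← sq_le_one_iff₀ (norm_nonneg _), ← normSq_eq_norm_sq,
        normSq_apply]
      rw [Fin.sum_univ_three] at hy
      simp
      nlinarith [sq_nonneg (y 0)]
    · rw [← ha, ← hp, ← hx]
      simp only [map_mul, map_add, conj_ofReal, conj_I]
      linear_combination u * (y 1 - I * y 2) * huu
  · rintro ⟨hp, hx, rfl⟩
    obtain ⟨u, hu, hup⟩ := exists_unit_sq_eq (-p)
    rw [norm_neg, hp, ofReal_one, mul_one] at hup
    have huu : u * starRingEnd ℂ u = 1 := by rw [mul_conj, normSq_eq_norm_sq, hu]; simp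
    set v := starRingEnd ℂ u * x with hv
    have hvn : v.re ^ 2 + v.im ^ 2 ≤ 1 := by
      rw [pow_two, pow_two, ← normSq_apply, normSq_eq_norm_sq, hv, norm_mul, RCLike.norm_conj, hu,
        one_mul]
      exact pow_le_one₀ (norm_nonneg _) hx
    -- The first coordinate is free to complete (Re v, Im v) to a unit vector, since only u² = -p
    -- and uv = x are prescribed.
    have hy : ∑ i, (![√(1 - v.re ^ 2 - v.im ^ 2), v.re, v.im] : Fin 3 → ℝ) i ^ 2 = 1 := by
      rw [Fin.sum_univ_three]
      simp only [Matrix.cons_val]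
      rw [Real.sq_sqrt (by linarith)]
      ring
    refine ⟨_, ⟨u, hu, _, hy, rfl⟩, ?_⟩
    rw [key u _ hy]
    simp only [Matrix.cons_val]
    have h1 : (v.re : ℂ) + I * v.im = v := by rw [mul_comm, re_add_im]
    have h2 : (v.re : ℂ) - I * v.im = starRingEnd ℂ v := by
      apply Complex.ext <;> simp
    have h3 : u * v = x := by rw [hv, ← mul_assoc, huu, one_mul]
    have h4 : -(u * starRingEnd ℂ v) = p * starRingEnd ℂ x := by
      rw [hv, map_mul, conj_conj]
      linear_combination starRingEnd ℂ x * hup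
    rw [h1, h2, h3, h4, ← hup, neg_neg]

theorem mainTheorem5 :
    -- the Shilov boundaries of the three domains exist
    IsLeast (closedBoundaries domainL4) (shilovBoundary domainL4) ∧
    IsLeast (closedBoundaries domainF) (shilovBoundary domainF) ∧
    IsLeast (closedBoundaries tetrablock) (shilovBoundary tetrablock) ∧
    IsBiholomorphismOn mapF domainL4 domainF ∧
    shilovBoundary domainF = mapF '' shilovBoundary domainL4 ∧
    ∀ x a p s : ℂ,
      List.TFAE [
        ![x, a, p, s] ∈ shilovBoundary domainF,
        ∃ θ x₁ x₂ x₃ x₄ : ℝ, x₁ ^ 2 + x₂ ^ 2 + x₃ ^ 2 + x₄ ^ 2 = 1 ∧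
          x = Complex.exp (Complex.I * θ) * (x₃ + Complex.I * x₄) ∧
          a = -(Complex.exp (Complex.I * θ) * (x₃ - Complex.I * x₄)) ∧
          p = -Complex.exp (2 * Complex.I * θ) ∧
          s = 2 * Complex.exp (Complex.I * θ) * x₂,
        ∃ z w η : ℂ, ‖z‖ ^ 2 + ‖w‖ ^ 2 ≤ 1 ∧ ‖η‖ = 1 ∧
          x = starRingEnd ℂ z ∧ a = -η * z ∧ p = -η ∧ s = w + starRingEnd ℂ w * η,
        ![x, a, p] ∈ shilovBoundary tetrablock ∧
          ∃ w : ℂ, ‖x‖ ^ 2 + ‖w‖ ^ 2 ≤ 1 ∧ s = w - starRingEnd ℂ w * p] := by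
  have hL := isLeast_closedBoundaries_domainL4
  have hF := isLeast_closedBoundaries_domainF
  have hE := isLeast_closedBoundaries_tetrablock
  rw [shilovBoundary_eq_of_isLeast hL, shilovBoundary_eq_of_isLeast hF,
    shilovBoundary_eq_of_isLeast hE]
  refine ⟨hL, hF, hE, isBiholomorphismOn_mapF, rfl, fun x a p s => ?_⟩
  rw [mem_image_mapF_lieSquareBoundary_iff, mem_image_mapE_lieSquareBoundary_iff]
  have hexp : ∀ θ : ℝ, exp (2 * I * θ) = exp (I * θ) ^ 2 := fun θ => by
    rw [← exp_nat_mul]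
    congr 1
    push_cast
    ring
  have hconj : ∀ {u : ℂ}, ‖u‖ = 1 → u * starRingEnd ℂ u = 1 := fun hu => by
    rw [mul_conj, normSq_eq_norm_sq, hu]; simp
  tfae_have 1 → 2 := by
    rintro ⟨u, hu, x₁, x₂, x₃, x₄, h, hx, ha, hp, hs⟩
    have hθ : exp (I * arg u) = u := by
      have := norm_mul_exp_arg_mul_I u
      rwa [hu, ofReal_one, one_mul, mul_comm] at this
    exact ⟨arg u, x₁, x₂, x₃, x₄, h, by rw [hθ, hx], by rw [hθ, ha], by rw [hexp, hθ, hp],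
      by rw [hθ, hs]⟩
  tfae_have 2 → 3 := by
    rintro ⟨θ, x₁, x₂, x₃, x₄, h, rfl, rfl, rfl, rfl⟩
    have hu : ‖exp (I * θ)‖ = 1 := by rw [mul_comm]; exact norm_exp_ofReal_mul_I θ
    rw [hexp]
    generalize exp (I * θ) = u at hu
    have huu := hconj hu
    -- With η = u² and w = ux₂, the conjugate of w times η is again ux₂, so the sum is 2ux₂.
    -- Dropping x₁ turns the equation of the sphere into an inequality.
    refine ⟨starRingEnd ℂ (u * (x₃ + I * x₄)), u * x₂, u ^ 2, ?_, by rw [norm_pow, hu, one_pow],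
      (conj_conj _).symm, ?_, rfl, ?_⟩
    · rw [RCLike.norm_conj, norm_mul, norm_mul, hu, one_mul, one_mul, norm_real, Real.norm_eq_abs,
        sq_abs, ← normSq_eq_norm_sq, normSq_apply]
      simp
      nlinarith [sq_nonneg x₁]
    · simp only [map_mul, map_add, conj_ofReal, conj_I]
      linear_combination u * (x₃ - I * x₄) * huu
    · simp only [map_mul, conj_ofReal]
      linear_combination -u * x₂ * huu
  tfae_have 3 → 4 := by
    rintro ⟨z, w, η, h, hη, rfl, rfl, rfl, rfl⟩
    refine ⟨⟨by rw [norm_neg, hη], ?_, by rw [conj_conj]⟩, w, by rwa [RCLike.norm_conj], by ring⟩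
    rw [RCLike.norm_conj, ← sq_le_one_iff₀ (norm_nonneg _)]
    linarith [sq_nonneg ‖w‖]
  tfae_have 4 → 1 := by
    rintro ⟨⟨hp, -, rfl⟩, w, h, rfl⟩
    obtain ⟨u, hu, hup⟩ := exists_unit_sq_eq (-p)
    rw [norm_neg, hp, ofReal_one, mul_one] at hup
    have huu := hconj hu
    obtain ⟨v, rfl⟩ : ∃ v, x = u * v :=
      ⟨starRingEnd ℂ u * x, by rw [← mul_assoc, huu, one_mul]⟩
    obtain ⟨t, rfl⟩ : ∃ t, w = u * t :=
      ⟨starRingEnd ℂ u * w, by rw [← mul_assoc, huu, one_mul]⟩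
    rw [norm_mul, norm_mul, hu, one_mul, one_mul, ← normSq_eq_norm_sq, ← normSq_eq_norm_sq,
      normSq_apply, normSq_apply] at h
    have hpu : p = -u ^ 2 := by rw [← hup, neg_neg]
    have h1 : (v.re : ℂ) + I * v.im = v := by rw [mul_comm, re_add_im]
    have h2 : (v.re : ℂ) - I * v.im = starRingEnd ℂ v := by apply Complex.ext <;> simp
    have h3 : t + starRingEnd ℂ t = 2 * t.re := by rw [add_conj]; push_cast; ring
    -- Since s = u(t + t̄) depends only on Re t, the square root absorbs (Im t)² along with the
    -- slack in the inequality.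
    refine ⟨u, hu, √(1 - t.re ^ 2 - v.re ^ 2 - v.im ^ 2), t.re, v.re, v.im, ?_, by rw [h1], ?_,
      hpu, ?_⟩
    · rw [Real.sq_sqrt (by nlinarith [sq_nonneg t.im])]
      ring
    · rw [h2, hpu, map_mul]
      linear_combination -u * starRingEnd ℂ v * huu
    · rw [hpu, map_mul]
      linear_combination u * starRingEnd ℂ t * huu + u * h3
  tfae_finish
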